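/- **Setting.** Let $K,L,A,B$ be non-empty finite sets, $M:K\times L\times A\times B\to\mathbb{R}$, $p\in\Delta(K)$, $q\in\Delta(L)$, $\lambda\in(0,1)$ and $T\ge 1$. Write $M^{kl}$ for the $|A|\times|B|$ matrix with entries $M^{kl}_{a,b}=M(k,l,a,b)$. In the $\lambda$-discounted $T$-stage game $\Gamma_{\lambda,T}(p,q)$ the types $k\sim p$ and $l\sim q$ are drawn independently; player 1 learns $k$, player 2 learns $l$; at each stage $t=1,\dots,T$ the players simultaneously choose $a_t\in A$, $b_t\in B$, which are then publicly announced. Put $h_t=(h_t^A,h_t^B)\in A^{t-1}\times B^{t-1}$ for the history before stage $t$. Behavior strategies are $\sigma=(\sigma_t)_{t=1}^T$ with $\sigma_t(k,h_t)\in\Delta(A)$ and $\tau=(\tau_t)_{t=1}^T$ with $\tau_t(l,h_t)\in\Delta(B)$. Player 1 maximizes and player 2 minimizes $$\gamma_{\lambda,T}(p,q,\sigma,\tau)=\mathbb{E}_{p,q,\sigma,\tau}\Big[\sum_{t=1}^T\lambda(1-\lambda)^{t-1}M(k,l,a_t,b_t)\Big].$$ A security strategy $\sigma$ of player 1 attains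 $\max_\sigma\min_\tau\gamma_{\lambda,T}$, a security strategy $\tau$ of player 2 attains $\min_\tau\max_\sigma\gamma_{\lambda,T}$; the value $V_{\lambda,T}(p,q)$ is the common value of these two levels. The realization plans of $\sigma$ and $\tau$ are $$x^{a_t}_{k,h_t}=p^k\prod_{s=1}^t\sigma_s^{a_s}(k,h_s),\qquad y^{b_t}_{l,h_t}=q^l\prod_{s=1}^t\tau_s^{b_s}(l,h_s)\qquad(1\le t\le T),$$ and an optimal realization plan is one that is generated by a security strategy and only by security strategies. For $x$ generated by $\sigma$ and $y$ generated by $\tau$, the anti-discounted weighted future security payoffs at stage $0$ are $$u_{l,0;\lambda,T}(x)=\min_{\tau'(l)}\sum_{k\in K}p^k\,\mathbb{E}_{\sigma(k),\tau'(l)}\Big[\sum_{s=1}^T\lambda(1-\lambda)^{s-1}M(k,l,a_s,b_s)\,\Big|\,k,l\Big],$$ $$w_{k,0;\lambda,T}(y)=\max_{\sigma'(k)}\sum_{l\in L}q^l\,\mathbb{E}_{\sigma'(k),\tau(l)}\Big[\sum_{s=1}^T\lambda(1-\lambda)^{s-1}M(k,l,a_s,b_s)\,\Big|\,k,l\Big].$$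 Let $X$ be the set of all real $x=(x^{a}_{k,h_t})_{1\le t\le T}$ with $x\ge 0$, $\sum_{a}x^{a}_{k,h_1}=p^k$ and $\sum_{a}x^{a}_{k,h_{t+1}}=x^{a_t}_{k,h_t}$ for $1\le t\le T-1$ and $h_{t+1}=(h_t,(a_t,b_t))$. Let $Y$ be the set of all real $y=(y^{b}_{l,h_t})_{1\le t\le T}$ with $y\ge 0$, $\sum_b y^b_{l,h_1}=q^l$ and $\sum_b y^b_{l,h_{t+1}}=y^{b_t}_{l,h_t}$. Let $U$, $W$ be the spaces of all families $u=(u_{l,h_t})$, $w=(w_{k,h_t})$, $1\le t\le T-1$, of real $|A|\times|B|$ matrices, and put $u_{l,h_T}=0$, $w_{k,h_T}=0$. **Theorem.** The game $\Gamma_{\lambda,T}(p,q)$ has a value $V_{\lambda,T}(p,q)$, and (1) $$V_{\lambda,T}(p,q)=\max_{x\in X,\;u\in U,\;u_{:,0}\in\mathbb{R}^{|L|}}\ \sum_{l\in L}q^l u_{l,0}$$ subject to $$\lambda\sum_{k\in K}(M^{kl})^{\mathsf T}x_{k,h_1}+(1-\lambda)\,u_{l,h_1}^{\mathsf T}\mathbf{1}\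 \ge\ u_{l,0}\mathbf{1}\qquad\forall l\in L,$$ $$\lambda\sum_{k\in K}(M^{kl})^{\mathsf T}x_{k,h_{t+1}}+(1-\lambda)\,u_{l,h_{t+1}}^{\mathsf T}\mathbf{1}\ \ge\ u_{l,h_t}^{a_t,b_t}\mathbf{1}\qquad\forall\,1\le t\le T-1,\ l\in L,\ h_{t+1}=(h_t,(a_t,b_t)).$$ For every optimal solution $(x^\star,u^\star,u^\star_{:,0})$, $x^\star$ is an optimal realization plan of player 1, and $u_{l,0;\lambda,T}(x^\star)=u^\star_{l,0}$ for every $l\in L$ with $q^l>0$. (2) $$V_{\lambda,T}(p,q)=\min_{y\in Y,\;w\in W,\;w_{:,0}\in\mathbb{R}^{|K|}}\ \sum_{k\in K}p^k w_{k,0}$$ subject to $$\lambda\sum_{l\in L}M^{kl}y_{l,h_1}+(1-\lambda)\,w_{k,h_1}\mathbf{1}\ \le\ w_{k,0}\mathbf{1}\qquad\forall k\in K,$$ $$\lambda\sum_{l\in L}M^{kl}y_{l,h_{t+1}}+(1-\lambda)\,w_{k,h_{t+1}}\mathbf{1}\ \le\ w_{k,h_t}^{a_t,b_t}\mathbf{1}\qquad\forall\,1\le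 t\le T-1,\ k\in K,\ h_{t+1}=(h_t,(a_t,b_t)).$$ For every optimal solution $(y^\star,w^\star,w^\star_{:,0})$, $y^\star$ is an optimal realization plan of player 2, and $w_{k,0;\lambda,T}(y^\star)=w^\star_{k,0}$ for every $k\in K$ with $p^k>0$. In particular, if $p$ and $q$ have full support, $u_{:,0;\lambda,T}(x^\star)=u^\star_{:,0}$ and $w_{:,0;\lambda,T}(y^\star)=w^\star_{:,0}$. -/

import Mathlib

open scoped BigOperators

noncomputable section

namespace DiscountedBayesianGame

/-! Conventions. `K`, `L` are the type sets and `A`, `B` the action sets of players 1 and 2.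
`Fin T` indexes the stages: `t : Fin T` is stage `t + 1`. At that stage the public history is the
sequence of the `t` action pairs played so far, an element of `Fin t → A × B`, which carries the same
information as the pair (history of player 1, history of player 2).
`Fin.snoc h (a, b)` is the history `h` followed by the action pair `(a, b)`. -/

/-- Behavior strategies over `T` stages, for one fixed type, of a player with action set `C`. -/
abbrev TypeStrategy (A B C : Type*) [Fintype C] (T : ℕ) : Type _ :=
  (t : Fin T) → (Fin t → A × B) → stdSimplex ℝ C

/-- Behavior strategies of player 1. -/
abbrev Strategy₁ (K A B : Type*) [Fintype A] (T : ℕ) : Type _ :=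
  K → TypeStrategy A B A T

/-- Behavior strategies of player 2. -/
abbrev Strategy₂ (L A B : Type*) [Fintype B] (T : ℕ) : Type _ :=
  L → TypeStrategy A B B T

/-- The first `m` action pairs of a sequence of `n` action pairs. -/
def firstPairs {A B : Type*} {n : ℕ} (ω : Fin n → A × B) (m : ℕ) (hm : m ≤ n) :
    Fin m → A × B :=
  fun s => ω (Fin.castLE hm s)

variable {K L A B : Type*} [Fintype K] [Fintype L] [Fintype A] [Fintype B] {T : ℕ}

/-! ### The truncated discounted game -/

/-- The probability of the play `ω` given the types, when player 1 (of the given type) uses `σ` and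
player 2 (of the given type) uses `τ`. -/
def playProb (σ : TypeStrategy A B A T) (τ : TypeStrategy A B B T) (ω : Fin T → A × B) : ℝ :=
  ∏ t : Fin T, ((σ t (firstPairs ω t t.isLt.le)).1 (ω t).1 *
    (τ t (firstPairs ω t t.isLt.le)).1 (ω t).2)

/-- The payoff of player 1: the expectation of `∑ₜ lam (1 - lam) ^ (t - 1) M(k, l, aₜ, bₜ)` over
`K × L × (A × B) ^ T` (stage `t` of the sum is the index `t - 1 : Fin T`). -/
def payoff (M : K → L → A → B → ℝ) (lam : ℝ) (p : stdSimplex ℝ K) (q : stdSimplex ℝ L)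
    (σ : Strategy₁ K A B T) (τ : Strategy₂ L A B T) : ℝ :=
  ∑ k, ∑ l, ∑ ω : Fin T → A × B, p.1 k * q.1 l * playProb (σ k) (τ l) ω *
    ∑ t : Fin T, lam * (1 - lam) ^ (t : ℕ) * M k l (ω t).1 (ω t).2

/-- `v` is the payoff that `σ` guarantees to player 1, `v = min_τ γ(σ, τ)`. -/
def Guarantees₁ (M : K → L → A → B → ℝ) (lam : ℝ) (p : stdSimplex ℝ K) (q : stdSimplex ℝ L)
    (σ : Strategy₁ K A B T) (v : ℝ) : Prop :=
  IsLeast (Set.range fun τ : Strategy₂ L A B T => payoff M lam p q σ τ) v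

/-- `v` is the payoff that `τ` guarantees to player 2, `v = max_σ γ(σ, τ)`. -/
def Guarantees₂ (M : K → L → A → B → ℝ) (lam : ℝ) (p : stdSimplex ℝ K) (q : stdSimplex ℝ L)
    (τ : Strategy₂ L A B T) (v : ℝ) : Prop :=
  IsGreatest (Set.range fun σ : Strategy₁ K A B T => payoff M lam p q σ τ) v

/-- `V` is the value of the `T`-stage game: it is both security levels, `max_σ min_τ γ(σ, τ)` and
`min_τ max_σ γ(σ, τ)`. -/
def IsValue (M : K → L → A → B → ℝ) (lam : ℝ) (p : stdSimplex ℝ K) (q : stdSimplex ℝ L)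
    (T : ℕ) (V : ℝ) : Prop :=
  IsGreatest {v | ∃ σ : Strategy₁ K A B T, Guarantees₁ M lam p q σ v} V ∧
  IsLeast {v | ∃ τ : Strategy₂ L A B T, Guarantees₂ M lam p q τ v} V

/-- `σ` achieves player 1's security level. -/
def IsSecurity₁ (M : K → L → A → B → ℝ) (lam : ℝ) (p : stdSimplex ℝ K) (q : stdSimplex ℝ L)
    (σ : Strategy₁ K A B T) : Prop :=
  ∃ V, IsGreatest {v | ∃ σ' : Strategy₁ K A B T, Guarantees₁ M lam p q σ' v} V ∧
    Guarantees₁ M lam p q σ V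

/-- `τ` achieves player 2's security level. -/
def IsSecurity₂ (M : K → L → A → B → ℝ) (lam : ℝ) (p : stdSimplex ℝ K) (q : stdSimplex ℝ L)
    (τ : Strategy₂ L A B T) : Prop :=
  ∃ V, IsLeast {v | ∃ τ' : Strategy₂ L A B T, Guarantees₂ M lam p q τ' v} V ∧
    Guarantees₂ M lam p q τ V

/-! ### Realization plans -/

/-- `p^k ∏_{s ≤ n} σ_s^{a_s}(k, h_s)` for the sequence `g` of the first `n` action pairs. -/
def weight₁ (p : stdSimplex ℝ K) (σ : Strategy₁ K A B T) (k : K) {n : ℕ} (hn : n ≤ T)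
    (g : Fin n → A × B) : ℝ :=
  p.1 k * ∏ s : Fin n, (σ k (Fin.castLE hn s) (firstPairs g s s.isLt.le)).1 (g s).1

/-- `q^l ∏_{s ≤ n} τ_s^{b_s}(l, h_s)` for the sequence `g` of the first `n` action pairs. -/
def weight₂ (q : stdSimplex ℝ L) (τ : Strategy₂ L A B T) (l : L) {n : ℕ} (hn : n ≤ T)
    (g : Fin n → A × B) : ℝ :=
  q.1 l * ∏ s : Fin n, (τ l (Fin.castLE hn s) (firstPairs g s s.isLt.le)).1 (g s).2

/-- Player 1's realization plan: `x_{k,h_t}^{a_t} = p^k ∏_{s ≤ t} σ_s^{a_s}(k, h_s)`. -/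
def realizationPlan₁ (p : stdSimplex ℝ K) (σ : Strategy₁ K A B T) :
    K → (t : Fin T) → (Fin t → A × B) → A → ℝ :=
  fun k t h a => weight₁ p σ k t.isLt.le h * (σ k t h).1 a

/-- Player 2's realization plan: `y_{l,h_t}^{b_t} = q^l ∏_{s ≤ t} τ_s^{b_s}(l, h_s)`. -/
def realizationPlan₂ (q : stdSimplex ℝ L) (τ : Strategy₂ L A B T) :
    L → (t : Fin T) → (Fin t → A × B) → B → ℝ :=
  fun l t h b => weight₂ q τ l t.isLt.le h * (τ l t h).1 b

/-- The set `X` of the linear program of player 1: `1ᵀ x_{k,h_t} = x_{k,h_{t-1}}^{a_{t-1}}`, with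
right-hand side `p^k` at the first stage, and `x ≥ 0`. -/
def planSet₁ (p : stdSimplex ℝ K) : Set (K → (t : Fin T) → (Fin t → A × B) → A → ℝ) :=
  {x | (∀ (hT : 0 < T) (k : K) (h : Fin 0 → A × B), ∑ a, x k ⟨0, hT⟩ h a = p.1 k) ∧
    (∀ (t : ℕ) (ht : t + 1 < T) (k : K) (h : Fin t → A × B) (a : A) (b : B),
      ∑ a', x k ⟨t + 1, ht⟩ (Fin.snoc (α := fun _ => A × B) h (a, b)) a' =
        x k ⟨t, t.lt_succ_self.trans ht⟩ h a) ∧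
    ∀ k t h a, 0 ≤ x k t h a}

/-- The set `Y` of the linear program of player 2: `1ᵀ y_{l,h_t} = y_{l,h_{t-1}}^{b_{t-1}}`, with
right-hand side `q^l` at the first stage, and `y ≥ 0`. -/
def planSet₂ (q : stdSimplex ℝ L) : Set (L → (t : Fin T) → (Fin t → A × B) → B → ℝ) :=
  {y | (∀ (hT : 0 < T) (l : L) (h : Fin 0 → A × B), ∑ b, y l ⟨0, hT⟩ h b = q.1 l) ∧
    (∀ (t : ℕ) (ht : t + 1 < T) (l : L) (h : Fin t → A × B) (a : A) (b : B),
      ∑ b', y l ⟨t + 1, ht⟩ (Fin.snoc (α := fun _ => A × B) h (a, b)) b' =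
        y l ⟨t, t.lt_succ_self.trans ht⟩ h b) ∧
    ∀ l t h b, 0 ≤ y l t h b}

/-! ### Anti-discounted weighted future security payoffs -/

/-- The expectation of the payoffs `∑_{s > n} lam (1 - lam) ^ (s - 1) M(k, l, a_s, b_s)` of the stages
after the first `n` ones, given the types and given that `g` was played at the first `n` stages, when
the players continue with `σ` and `τ`. -/
def condFuturePayoff (Mkl : A → B → ℝ) (lam : ℝ) (σ : TypeStrategy A B A T)
    (τ : TypeStrategy A B B T) {n : ℕ} (hn : n ≤ T) (g : Fin n → A × B) : ℝ :=
  open Classical in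
  ∑ ω ∈ Finset.univ.filter (fun ω : Fin T → A × B => firstPairs ω n hn = g),
    (∏ t ∈ Finset.univ.filter (fun t : Fin T => n ≤ (t : ℕ)),
      ((σ t (firstPairs ω t t.isLt.le)).1 (ω t).1 * (τ t (firstPairs ω t t.isLt.le)).1 (ω t).2)) *
    ∑ t ∈ Finset.univ.filter (fun t : Fin T => n ≤ (t : ℕ)),
      lam * (1 - lam) ^ (t : ℕ) * Mkl (ω t).1 (ω t).2

/-- `v` is the anti-discounted weighted future security payoff `u_{l,h_n;lam,T}^{a_n,b_n}(x)` after
the first `n` stages, in which `g = (h_n, (a_n, b_n))` was played; `x` is the realization plan of `σ`.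
For `n = 0` this is `u_{l,0;lam,T}(x)`. -/
def IsFutureSecurityPayoff₁ (M : K → L → A → B → ℝ) (lam : ℝ) (p : stdSimplex ℝ K)
    (σ : Strategy₁ K A B T) (l : L) {n : ℕ} (hn : n ≤ T) (g : Fin n → A × B) (v : ℝ) : Prop :=
  IsLeast (Set.range fun τ : TypeStrategy A B B T =>
    ((1 - lam) ^ n)⁻¹ * ∑ k, weight₁ p σ k hn g * condFuturePayoff (M k l) lam (σ k) τ hn g) v

/-- `v` is the anti-discounted weighted future security payoff `w_{k,h_n;lam,T}^{a_n,b_n}(y)` after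
the first `n` stages, in which `g = (h_n, (a_n, b_n))` was played; `y` is the realization plan of `τ`.
For `n = 0` this is `w_{k,0;lam,T}(y)`. -/
def IsFutureSecurityPayoff₂ (M : K → L → A → B → ℝ) (lam : ℝ) (q : stdSimplex ℝ L)
    (τ : Strategy₂ L A B T) (k : K) {n : ℕ} (hn : n ≤ T) (g : Fin n → A × B) (v : ℝ) : Prop :=
  IsGreatest (Set.range fun σ : TypeStrategy A B A T =>
    ((1 - lam) ^ n)⁻¹ * ∑ l, weight₂ q τ l hn g * condFuturePayoff (M k l) lam σ (τ l) hn g) v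

/-! ### The linear programs -/

/-- Feasibility in the linear program of player 1. `u l t h` is the `|A| × |B|` matrix
`u_{l,h;lam,T}` at stage `t + 1`; it is the zero matrix at the last stage. `u₀ l` is
`u_{l,0;lam,T}`. -/
structure Feasible₁ (M : K → L → A → B → ℝ) (lam : ℝ) (p : stdSimplex ℝ K)
    (x : K → (t : Fin T) → (Fin t → A × B) → A → ℝ)
    (u : L → (t : Fin T) → (Fin t → A × B) → A → B → ℝ) (u₀ : L → ℝ) : Prop where
  plan : x ∈ planSet₁ p
  first : ∀ (hT : 0 < T) (l : L) (h : Fin 0 → A × B) (b : B),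
    u₀ l ≤ lam * ∑ k, ∑ a, M k l a b * x k ⟨0, hT⟩ h a + (1 - lam) * ∑ a, u l ⟨0, hT⟩ h a b
  next : ∀ (t : ℕ) (ht : t + 1 < T) (l : L) (h : Fin t → A × B) (a : A) (b : B) (b' : B),
    u l ⟨t, t.lt_succ_self.trans ht⟩ h a b ≤
      lam * ∑ k, ∑ a', M k l a' b' *
        x k ⟨t + 1, ht⟩ (Fin.snoc (α := fun _ => A × B) h (a, b)) a' +
      (1 - lam) * ∑ a', u l ⟨t + 1, ht⟩ (Fin.snoc (α := fun _ => A × B) h (a, b)) a' b'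
  last : ∀ (t : Fin T), (t : ℕ) + 1 = T → ∀ l h a b, u l t h a b = 0

/-- Feasibility in the linear program of player 2. `w k t h` is the `|A| × |B|` matrix
`w_{k,h;lam,T}` at stage `t + 1`; it is the zero matrix at the last stage. `w₀ k` is
`w_{k,0;lam,T}`. -/
structure Feasible₂ (M : K → L → A → B → ℝ) (lam : ℝ) (q : stdSimplex ℝ L)
    (y : L → (t : Fin T) → (Fin t → A × B) → B → ℝ)
    (w : K → (t : Fin T) → (Fin t → A × B) → A → B → ℝ) (w₀ : K → ℝ) : Prop where
  plan : y ∈ planSet₂ q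
  first : ∀ (hT : 0 < T) (k : K) (h : Fin 0 → A × B) (a : A),
    lam * ∑ l, ∑ b, M k l a b * y l ⟨0, hT⟩ h b + (1 - lam) * ∑ b, w k ⟨0, hT⟩ h a b ≤ w₀ k
  next : ∀ (t : ℕ) (ht : t + 1 < T) (k : K) (h : Fin t → A × B) (a : A) (b : B) (a' : A),
      lam * ∑ l, ∑ b', M k l a' b' *
        y l ⟨t + 1, ht⟩ (Fin.snoc (α := fun _ => A × B) h (a, b)) b' +
      (1 - lam) * ∑ b', w k ⟨t + 1, ht⟩ (Fin.snoc (α := fun _ => A × B) h (a, b)) a' b' ≤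
    w k ⟨t, t.lt_succ_self.trans ht⟩ h a b
  last : ∀ (t : Fin T), (t : ℕ) + 1 = T → ∀ k h a b, w k t h a b = 0

end DiscountedBayesianGame

end

open DiscountedBayesianGame

noncomputable section

namespace DiscountedBayesianGame

/-! ### Sums over histories -/

/-! The game is bilinear in the realization plans, and each linear program writes out one player's
security problem with the opponent's best response replaced by its Bellman inequalities.

The plan sets are compact convex polytopes, and every plan comes from a behavior strategy
(`IsTypePlan.exists_typePlan`). The expected payoff depends on the strategies only through their
plans, bilinearly (`payoff_eq_planPayoff`). Sion's theorem then gives a saddle point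
(`exists_saddle`), whose payoff is the value.

For a fixed plan of player 1, each type of player 2 solves a finite-horizon control problem whose
stage payoff depends on the history. Up to the factor `(1 - lam) ^ (t + 1)`, the LP constraints are
the Bellman inequalities of this problem (`feasible₁_iff`). Hence any feasible initial value is a
lower bound on the payoff against every response (`IsBellman.le_sum`), and backward induction
produces a tight one (`exists_isBellman_eq_sum`). Optimizing over plans as well yields the value.
Player 2's program reduces to the same control problem by a change of sign; the projection `π` from
action pairs to own actions lets one argument serve both players.

At an LP optimum the weighted bounds sum to the value, while the saddle strategy of the opponent
pays no more than that in player 1's program (no less in player 2's). So the bounds are equalities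
for every type of positive probability (`eq_of_sum_mul_le`). -/

theorem sum_snoc {P R : Type*} [Fintype P] [AddCommMonoid R] {n : ℕ} (f : (Fin (n + 1) → P) → R) :
    ∑ g, f g = ∑ h : Fin n → P, ∑ p, f (Fin.snoc (α := fun _ => P) h p) := by
  rw [← (Fin.snocEquiv fun _ : Fin (n + 1) => P).sum_comp f, Fintype.sum_prod_type_right]
  rfl

theorem firstPairs_snoc {A B : Type*} {n : ℕ} (h : Fin n → A × B) (p : A × B) (m : ℕ)
    (hm : m ≤ n) :
    firstPairs (Fin.snoc (α := fun _ => A × B) h p) m (hm.trans n.le_succ) = firstPairs h m hm := by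
  funext s
  exact Fin.snoc_castSucc (α := fun _ => A × B) p h (Fin.castLE hm s)

/-! ### Realization plans of a single type -/

section TypePlan

variable {A B C : Type*} [Fintype C] {T : ℕ}

/-- The realization probability of the own actions along `g` under a strategy for one type, where
`π` reads off the own action from an action pair. -/
def pathWeight (π : A × B → C) (σ : TypeStrategy A B C T) {n : ℕ} (hn : n ≤ T)
    (g : Fin n → A × B) : ℝ :=
  ∏ s : Fin n, (σ (Fin.castLE hn s) (firstPairs g s s.isLt.le)).1 (π (g s))

/-- The realization plan, with total mass `1`, of a strategy for one type. -/
def typePlan (π : A × B → C) (σ : TypeStrategy A B C T) (t : Fin T) (h : Fin t → A × B) (c : C) :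
    ℝ :=
  pathWeight π σ t.isLt.le h * (σ t h).1 c

/-- The realization plans with total mass `r` of one type. -/
structure IsTypePlan (π : A × B → C) (r : ℝ) (x : (t : Fin T) → (Fin t → A × B) → C → ℝ) :
    Prop where
  first : ∀ (hT : 0 < T) (h : Fin 0 → A × B), ∑ c, x ⟨0, hT⟩ h c = r
  next : ∀ (t : ℕ) (ht : t + 1 < T) (h : Fin t → A × B) (p : A × B),
    ∑ c, x ⟨t + 1, ht⟩ (Fin.snoc (α := fun _ => A × B) h p) c =
      x ⟨t, t.lt_succ_self.trans ht⟩ h (π p)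
  nonneg : ∀ t h c, 0 ≤ x t h c

theorem pathWeight_zero (π : A × B → C) (σ : TypeStrategy A B C T) (hn : 0 ≤ T)
    (g : Fin 0 → A × B) : pathWeight π σ hn g = 1 := by
  simp [pathWeight]

theorem pathWeight_snoc (π : A × B → C) (σ : TypeStrategy A B C T) {n : ℕ} (hn : n < T)
    (h : Fin n → A × B) (p : A × B) :
    pathWeight π σ (n := n + 1) hn (Fin.snoc (α := fun _ => A × B) h p) =
      typePlan π σ ⟨n, hn⟩ h (π p) := by
  unfold typePlan pathWeight
  rw [Fin.prod_univ_castSucc]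
  congr 1
  · refine Finset.prod_congr rfl fun s _ => ?_
    rw [Fin.snoc_castSucc (α := fun _ => A × B)]
    exact congrArg (fun g => (σ (Fin.castLE hn.le s) g).1 (π (h s)))
      (firstPairs_snoc h p s s.isLt.le)
  · rw [Fin.snoc_last (α := fun _ => A × B)]
    exact congrArg (fun g => (σ ⟨n, hn⟩ g).1 (π p)) (firstPairs_snoc h p n le_rfl)

theorem pathWeight_nonneg (π : A × B → C) (σ : TypeStrategy A B C T) {n : ℕ} (hn : n ≤ T)
    (g : Fin n → A × B) : 0 ≤ pathWeight π σ hn g :=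
  Finset.prod_nonneg fun _ _ => (σ _ _).2.1 _

theorem isTypePlan_typePlan (π : A × B → C) (σ : TypeStrategy A B C T) {r : ℝ} (hr : 0 ≤ r) :
    IsTypePlan π r fun t h c => r * typePlan π σ t h c where
  first hT h := by
    rw [← Finset.mul_sum]
    simp only [typePlan]
    rw [← Finset.mul_sum, pathWeight_zero, (σ _ _).2.2, mul_one, mul_one]
  next t ht h p := by
    rw [← Finset.mul_sum]
    simp only [typePlan]
    rw [← Finset.mul_sum, (σ _ _).2.2, mul_one,
      pathWeight_snoc π σ (t.lt_succ_self.trans ht)]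
    rfl
  nonneg t h c := mul_nonneg hr (mul_nonneg (pathWeight_nonneg _ _ _ _) ((σ _ _).2.1 _))

/-- The strategy is the conditional distribution of the plan at each history. The flow constraints
make the products of these conditionals telescope back to the plan. -/
theorem IsTypePlan.exists_typePlan [Nonempty C] {π : A × B → C} {r : ℝ}
    {x : (t : Fin T) → (Fin t → A × B) → C → ℝ} (hx : IsTypePlan π r x) :
    ∃ σ : TypeStrategy A B C T, ∀ t h c, r * typePlan π σ t h c = x t h c := by
  classical
  have key : ∀ (t : Fin T) (h : Fin t → A × B), ∃ s : stdSimplex ℝ C,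
      ∀ c, (∑ c', x t h c') * s.1 c = x t h c := by
    intro t h
    by_cases h0 : ∑ c', x t h c' = 0
    -- A history of zero mass leaves the behavior free; any point mass will do, since all entries of
    -- the plan vanish there.
    · obtain ⟨c₀⟩ := ‹Nonempty C›
      refine ⟨⟨Pi.single c₀ 1, single_mem_stdSimplex ℝ c₀⟩, fun c => ?_⟩
      rw [h0, zero_mul,
        (Finset.sum_eq_zero_iff_of_nonneg fun c _ => hx.nonneg t h c).1 h0 c (Finset.mem_univ c)]
    · refine ⟨⟨fun c => x t h c / ∑ c', x t h c', fun c => ?_, ?_⟩, fun c => ?_⟩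
      · exact div_nonneg (hx.nonneg t h c) (Finset.sum_nonneg fun c _ => hx.nonneg t h c)
      · rw [← Finset.sum_div, div_self h0]
      · exact mul_div_cancel₀ _ h0
  choose σ hσ using key
  refine ⟨σ, ?_⟩
  -- The mass reaching a history under `σ` is the normalizing constant used there.
  have main : ∀ (n : ℕ) (hn : n < T) (h : Fin n → A × B),
      r * pathWeight π σ hn.le h = ∑ c', x ⟨n, hn⟩ h c' := by
    intro n
    induction n with
    | zero => intro hn h; rw [pathWeight_zero, mul_one, hx.first]
    | succ n ih =>
      intro hn h
      obtain ⟨g, p, rfl⟩ : ∃ (g : Fin n → A × B) (p : A × B),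
          h = Fin.snoc (α := fun _ => A × B) g p :=
        ⟨Fin.init (α := fun _ => A × B) h, h (Fin.last n),
          (Fin.snoc_init_self (α := fun _ => A × B) h).symm⟩
      rw [pathWeight_snoc π σ (n.lt_succ_self.trans hn), hx.next n hn, typePlan, ← mul_assoc, ih]
      exact hσ ⟨n, _⟩ g (π p)
  intro t h c
  rw [typePlan, ← mul_assoc, main t t.isLt h]
  exact hσ t h c

end TypePlan

/-! ### The expected payoff in terms of realization plans -/

section Expectation

variable {A B : Type*} [Fintype A] [Fintype B]

theorem playProb_eq {T : ℕ} (σ : TypeStrategy A B A T) (τ : TypeStrategy A B B T)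
    (ω : Fin T → A × B) :
    playProb σ τ ω = pathWeight Prod.fst σ le_rfl ω * pathWeight Prod.snd τ le_rfl ω :=
  Finset.prod_mul_distrib

theorem playProb_snoc {T : ℕ} (σ : TypeStrategy A B A (T + 1)) (τ : TypeStrategy A B B (T + 1))
    (ω : Fin T → A × B) (p : A × B) :
    playProb σ τ (Fin.snoc (α := fun _ => A × B) ω p) =
      typePlan Prod.fst σ (Fin.last T) ω p.1 * typePlan Prod.snd τ (Fin.last T) ω p.2 := by
  rw [playProb_eq, pathWeight_snoc _ _ T.lt_succ_self, pathWeight_snoc _ _ T.lt_succ_self]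
  rfl

/-- By linearity of expectation, only the marginal law of each stage matters. The induction peels
off the last stage, whose action probabilities sum to one and so do not affect the earlier terms. -/
theorem sum_playProb_mul {T : ℕ} (σ : TypeStrategy A B A T) (τ : TypeStrategy A B B T)
    (f : Fin T → A × B → ℝ) :
    ∑ ω : Fin T → A × B, playProb σ τ ω * ∑ t, f t (ω t) =
      ∑ t : Fin T, ∑ h : Fin t → A × B, ∑ p : A × B,
        f t p * (typePlan Prod.fst σ t h p.1 * typePlan Prod.snd τ t h p.2) := by
  induction T with
  | zero => simp
  | succ T ih =>
    rw [Fin.sum_univ_castSucc, sum_snoc]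
    -- The induction hypothesis is applied to the game truncated before its last stage.
    have ih' := ih (fun t => σ t.castSucc) (fun t => τ t.castSucc) (fun t => f t.castSucc)
    refine Eq.trans ?_ (congrArg₂ (· + ·) ih' rfl)
    refine Eq.trans ?_ Finset.sum_add_distrib
    refine Finset.sum_congr rfl fun ω _ => ?_
    simp only [playProb_snoc, Fin.sum_univ_castSucc, Fin.snoc_castSucc (α := fun _ => A × B),
      Fin.snoc_last (α := fun _ => A × B), mul_add, Finset.sum_add_distrib]
    congr 1
    · rw [← Finset.sum_mul]
      congr 1
      rw [playProb_eq, Fintype.sum_prod_type]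
      simp only [typePlan, ← Finset.mul_sum, ← Finset.sum_mul, (σ _ _).2.2, (τ _ _).2.2, mul_one]
      rfl
    · exact Finset.sum_congr rfl fun p _ => mul_comm _ _

end Expectation

/-! ### Dynamic programming against a fixed stage payoff -/

section FiberSum

variable {A B C : Type*} [Fintype A] [Fintype B]

/-- The sum of `U` over the action pairs in which `π` reads off the action `c`. -/
def fiberSum (π : A × B → C) (U : A × B → ℝ) (c : C) : ℝ :=
  open Classical in ∑ p with π p = c, U p

/-- The continuation value of an own action adds up over the opponent's actions without weights: the
opponent's probabilities are already contained in the values. This identity moves between that form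
and sums over action pairs. -/
theorem sum_fiberSum_mul [Fintype C] (π : A × B → C) (U : A × B → ℝ) (f : C → ℝ) :
    ∑ c, fiberSum π U c * f c = ∑ p, U p * f (π p) := by
  classical
  rw [← Finset.sum_fiberwise Finset.univ π]
  refine Finset.sum_congr rfl fun c _ => ?_
  rw [fiberSum, Finset.sum_mul]
  exact Finset.sum_congr (by congr) fun p hp => by rw [(Finset.mem_filter.1 hp).2]

theorem fiberSum_fst (U : A × B → ℝ) (a : A) : fiberSum Prod.fst U a = ∑ b, U (a, b) := by
  classical
  have h := sum_fiberSum_mul Prod.fst U (Pi.single a 1)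
  rw [Fintype.sum_prod_type] at h
  simpa [Pi.single_apply] using h

theorem fiberSum_snd (U : A × B → ℝ) (b : B) : fiberSum Prod.snd U b = ∑ a, U (a, b) := by
  classical
  have h := sum_fiberSum_mul Prod.snd U (Pi.single b 1)
  rw [Fintype.sum_prod_type] at h
  simpa [Pi.single_apply] using h

theorem fiberSum_neg (π : A × B → C) (U : A × B → ℝ) (c : C) :
    fiberSum π (fun p => -U p) c = -fiberSum π U c :=
  Finset.sum_neg_distrib _

end FiberSum

section DynamicProgramming

variable {A B C : Type*} [Fintype A] [Fintype B] [Fintype C] {T : ℕ}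

/-- If the Bellman inequalities hold wherever the plan `y` puts positive mass, then the initial
value `u₀` is at most the total payoff of `y`. -/
theorem IsTypePlan.le_sum_of_mul {π : A × B → C}
    {y : (t : Fin T) → (Fin t → A × B) → C → ℝ} (hy : IsTypePlan π 1 y) (hT : 0 < T)
    (G : (t : Fin T) → (Fin t → A × B) → C → ℝ)
    (U : (t : Fin T) → (Fin t → A × B) → A × B → ℝ) (u₀ : ℝ)
    (first : ∀ (h : Fin 0 → A × B) (c : C), u₀ * y ⟨0, hT⟩ h c ≤
      (G ⟨0, hT⟩ h c + fiberSum π (U ⟨0, hT⟩ h) c) * y ⟨0, hT⟩ h c)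
    (next : ∀ (t : ℕ) (ht : t + 1 < T) (h : Fin t → A × B) (p : A × B) (c : C),
      U ⟨t, t.lt_succ_self.trans ht⟩ h p *
          y ⟨t + 1, ht⟩ (Fin.snoc (α := fun _ => A × B) h p) c ≤
        (G ⟨t + 1, ht⟩ (Fin.snoc (α := fun _ => A × B) h p) c +
          fiberSum π (U ⟨t + 1, ht⟩ (Fin.snoc (α := fun _ => A × B) h p)) c) *
          y ⟨t + 1, ht⟩ (Fin.snoc (α := fun _ => A × B) h p) c)
    (last : ∀ t : Fin T, (t : ℕ) + 1 = T → ∀ h p, U t h p = 0) :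
    u₀ ≤ ∑ t, ∑ h, ∑ c, G t h c * y t h c := by
  set F : ℕ → ℝ := fun n =>
    if hn : n < T then ∑ h, ∑ c, G ⟨n, hn⟩ h c * y ⟨n, hn⟩ h c else 0 with hF
  have hFn : ∀ n (hn : n < T), F n = ∑ h, ∑ c, G ⟨n, hn⟩ h c * y ⟨n, hn⟩ h c := fun n hn => by
    simp only [hF, dif_pos hn]
  -- Invariant: `u₀` is bounded by the payoff of the stages up to index `n` plus the continuation
  -- values weighted by `y`.
  have key : ∀ (n : ℕ) (hn : n < T), u₀ ≤ ∑ i ∈ Finset.range (n + 1), F i +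
      ∑ h, ∑ p, U ⟨n, hn⟩ h p * y ⟨n, hn⟩ h (π p) := by
    intro n
    induction n with
    | zero =>
      intro hn
      -- There is one empty history, and `y` has total mass 1 on it.
      have h1 : u₀ = ∑ h : Fin 0 → A × B, ∑ c, u₀ * y ⟨0, hn⟩ h c := by
        simp only [← Finset.mul_sum, hy.first hn]
        simp
      rw [Finset.sum_range_one, hFn 0 hn, ← Finset.sum_add_distrib]
      refine h1.le.trans (Finset.sum_le_sum fun h _ => ?_)
      rw [← sum_fiberSum_mul, ← Finset.sum_add_distrib]
      refine Finset.sum_le_sum fun c _ => (first h c).trans_eq (add_mul _ _ _)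
    | succ n ih =>
      intro hn
      refine (ih (n.lt_succ_self.trans hn)).trans ?_
      rw [Finset.sum_range_succ _ (n + 1), add_assoc]
      refine add_le_add_right ?_ _
      rw [hFn (n + 1) hn, ← Finset.sum_add_distrib]
      refine le_of_le_of_eq ?_ (sum_snoc _).symm
      refine Finset.sum_le_sum fun h _ => Finset.sum_le_sum fun p _ => ?_
      -- The flow constraint spreads the mass on the action `π p` over the actions of the next
      -- stage, where `next` applies.
      rw [← sum_fiberSum_mul, ← Finset.sum_add_distrib, ← hy.next n hn h p, Finset.mul_sum]
      exact Finset.sum_le_sum fun c _ => (next n hn h p c).trans_eq (add_mul _ _ _)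
  obtain ⟨n, rfl⟩ : ∃ n, T = n + 1 := ⟨T - 1, (Nat.sub_add_cancel hT).symm⟩
  refine (key n n.lt_succ_self).trans_eq ?_
  rw [Finset.sum_eq_zero fun h _ => Finset.sum_eq_zero fun p _ => by
    rw [last ⟨n, n.lt_succ_self⟩ rfl, zero_mul], add_zero, Finset.sum_range]
  exact Finset.sum_congr rfl fun t _ => hFn t t.isLt

/-- The Bellman inequalities of a minimizer facing the stage payoff `G`: `U t h p` is a lower bound
for the payoff after the history `h` followed by `p`, and `u₀` one for the whole payoff. -/
structure IsBellman (π : A × B → C) (G : (t : Fin T) → (Fin t → A × B) → C → ℝ)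
    (U : (t : Fin T) → (Fin t → A × B) → A × B → ℝ) (u₀ : ℝ) : Prop where
  first : ∀ (hT : 0 < T) (h : Fin 0 → A × B) (c : C),
    u₀ ≤ G ⟨0, hT⟩ h c + fiberSum π (U ⟨0, hT⟩ h) c
  next : ∀ (t : ℕ) (ht : t + 1 < T) (h : Fin t → A × B) (p : A × B) (c : C),
    U ⟨t, t.lt_succ_self.trans ht⟩ h p ≤
      G ⟨t + 1, ht⟩ (Fin.snoc (α := fun _ => A × B) h p) c +
        fiberSum π (U ⟨t + 1, ht⟩ (Fin.snoc (α := fun _ => A × B) h p)) c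
  last : ∀ t : Fin T, (t : ℕ) + 1 = T → ∀ h p, U t h p = 0

theorem IsBellman.le_sum {π : A × B → C} {G : (t : Fin T) → (Fin t → A × B) → C → ℝ}
    {U : (t : Fin T) → (Fin t → A × B) → A × B → ℝ} {u₀ : ℝ} (hU : IsBellman π G U u₀)
    (hT : 0 < T) (τ : TypeStrategy A B C T) :
    u₀ ≤ ∑ t, ∑ h, ∑ c, G t h c * typePlan π τ t h c := by
  have hy : IsTypePlan π 1 (typePlan π τ) := by
    simpa using isTypePlan_typePlan π τ zero_le_one
  exact hy.le_sum_of_mul hT G U u₀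
    (fun h c => mul_le_mul_of_nonneg_right (hU.first hT h c) (hy.nonneg _ _ _))
    (fun t ht h p c => mul_le_mul_of_nonneg_right (hU.next t ht h p c) (hy.nonneg _ _ _)) hU.last

/-- The Bellman value with `m` stages to go, after the history `h` of length `n`. -/
def bellmanValue (π : A × B → C) (G : (n : ℕ) → (Fin n → A × B) → C → ℝ) :
    ℕ → (n : ℕ) → (Fin n → A × B) → ℝ
  | 0, _, _ => 0
  | m + 1, n, h => ⨅ c, (G n h c + fiberSum π
      (fun p => bellmanValue π G m (n + 1) (Fin.snoc (α := fun _ => A × B) h p)) c)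

/-- Backward induction: some solution of the Bellman inequalities is attained by a strategy. -/
theorem exists_isBellman_eq_sum [Nonempty C] (π : A × B → C) (hT : 0 < T)
    (G : (t : Fin T) → (Fin t → A × B) → C → ℝ) :
    ∃ (U : (t : Fin T) → (Fin t → A × B) → A × B → ℝ) (u₀ : ℝ) (τ : TypeStrategy A B C T),
      IsBellman π G U u₀ ∧ ∑ t, ∑ h, ∑ c, G t h c * typePlan π τ t h c = u₀ := by
  classical
  -- Extension by zero beyond the horizon, so that the recursion can run over all natural numbers.
  set G' : (n : ℕ) → (Fin n → A × B) → C → ℝ := fun n h c =>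
    if hn : n < T then G ⟨n, hn⟩ h c else 0 with hG'
  set U : (t : Fin T) → (Fin t → A × B) → A × B → ℝ := fun t h p =>
    bellmanValue π G' (T - (t + 1)) (t + 1) (Fin.snoc (α := fun _ => A × B) h p) with hU
  have hval : ∀ (n : ℕ) (hn : n < T) (h : Fin n → A × B), bellmanValue π G' (T - n) n h =
      ⨅ c, (G ⟨n, hn⟩ h c + fiberSum π (U ⟨n, hn⟩ h) c) := by
    intro n hn h
    rw [show T - n = T - (n + 1) + 1 by omega, bellmanValue]
    simp only [hG', dif_pos hn, hU]
  have hmin : ∀ (t : Fin T) (h : Fin t → A × B), ∃ c,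
      G t h c + fiberSum π (U t h) c = bellmanValue π G' (T - t) t h := by
    intro t h
    obtain ⟨c, hc⟩ := exists_eq_ciInf_of_finite (f := fun c => G t h c + fiberSum π (U t h) c)
    exact ⟨c, hc.trans (hval t t.isLt h).symm⟩
  choose best hbest using hmin
  let τ : TypeStrategy A B C T := fun t h =>
    ⟨Pi.single (best t h) 1, single_mem_stdSimplex ℝ (best t h)⟩
  have hB : IsBellman π G U (bellmanValue π G' T 0 Fin.elim0) := by
    refine ⟨fun hT h c => ?_, fun t ht h p c => ?_, fun t ht h p => ?_⟩
    · rw [Subsingleton.elim h Fin.elim0]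
      refine (hval 0 hT _).trans_le ?_
      exact ciInf_le (Set.finite_range _).bddBelow c
    · refine (hval (t + 1) ht _).trans_le ?_
      exact ciInf_le (Set.finite_range _).bddBelow c
    · simp only [hU, ht, Nat.sub_self, bellmanValue]
  have hy : IsTypePlan π 1 (typePlan π τ) := by
    simpa using isTypePlan_typePlan π τ zero_le_one
  -- Complementary slackness: wherever the plan of `τ` has mass, the action is a minimizer and the
  -- Bellman inequality is an equality.
  have hτ : ∀ t h c, (G t h c + fiberSum π (U t h) c) * typePlan π τ t h c =
      bellmanValue π G' (T - t) t h * typePlan π τ t h c := by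
    intro t h c
    by_cases hc : c = best t h
    · rw [hc, hbest]
    · have : typePlan π τ t h c = 0 := by
        simp [typePlan, τ, hc]
      rw [this, mul_zero, mul_zero]
  refine ⟨U, _, τ, hB, le_antisymm ?_ (hB.le_sum hT τ)⟩
  -- Equality on the support lets the same estimate run on the negated data, giving the reverse
  -- bound. This is why the estimate assumes only inequalities multiplied by the plan.
  have := hy.le_sum_of_mul hT (fun t h c => -G t h c) (fun t h p => -U t h p)
    (-bellmanValue π G' T 0 Fin.elim0) (fun h c => ?_) (fun t ht h p c => ?_) fun t ht h p => by
      rw [hB.last t ht, neg_zero]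
  · simp only [neg_mul, Finset.sum_neg_distrib] at this
    exact neg_le_neg_iff.1 this
  · rw [fiberSum_neg, ← neg_add, neg_mul, neg_mul, hτ, Subsingleton.elim h Fin.elim0]
    rfl
  · rw [fiberSum_neg, ← neg_add, neg_mul, neg_mul, hτ]

end DynamicProgramming

/-! ### The plan sets -/

section PlanSets

variable {K L A B C : Type*} [Fintype K] [Fintype L] [Fintype C] {T : ℕ}

theorem mem_planSet₁_iff [Fintype A] {p : stdSimplex ℝ K} {x : K → (t : Fin T) → (Fin t → A × B) → A → ℝ} :
    x ∈ planSet₁ p ↔ ∀ k, IsTypePlan Prod.fst (p.1 k) (x k) :=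
  ⟨fun h k => ⟨fun hT => h.1 hT k, fun t ht g c => h.2.1 t ht k g c.1 c.2, h.2.2 k⟩,
    fun h => ⟨fun hT k => (h k).first hT, fun t ht k g a b => (h k).next t ht g (a, b),
      fun k => (h k).nonneg⟩⟩

theorem mem_planSet₂_iff [Fintype B] {q : stdSimplex ℝ L} {y : L → (t : Fin T) → (Fin t → A × B) → B → ℝ} :
    y ∈ planSet₂ q ↔ ∀ l, IsTypePlan Prod.snd (q.1 l) (y l) :=
  ⟨fun h l => ⟨fun hT => h.1 hT l, fun t ht g c => h.2.1 t ht l g c.1 c.2, h.2.2 l⟩,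
    fun h => ⟨fun hT l => (h l).first hT, fun t ht l g a b => (h l).next t ht g (a, b),
      fun l => (h l).nonneg⟩⟩

theorem realizationPlan₁_eq [Fintype A] (p : stdSimplex ℝ K) (σ : Strategy₁ K A B T) :
    realizationPlan₁ p σ = fun k t h a => p.1 k * typePlan Prod.fst (σ k) t h a := by
  funext k t h a
  exact mul_assoc _ _ _

theorem realizationPlan₂_eq [Fintype B] (q : stdSimplex ℝ L) (τ : Strategy₂ L A B T) :
    realizationPlan₂ q τ = fun l t h b => q.1 l * typePlan Prod.snd (τ l) t h b := by
  funext l t h b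
  exact mul_assoc _ _ _

theorem realizationPlan₁_mem [Fintype A] (p : stdSimplex ℝ K) (σ : Strategy₁ K A B T) :
    realizationPlan₁ p σ ∈ planSet₁ p := by
  rw [realizationPlan₁_eq, mem_planSet₁_iff]
  exact fun k => isTypePlan_typePlan _ _ (p.2.1 k)

theorem realizationPlan₂_mem [Fintype B] (q : stdSimplex ℝ L) (τ : Strategy₂ L A B T) :
    realizationPlan₂ q τ ∈ planSet₂ q := by
  rw [realizationPlan₂_eq, mem_planSet₂_iff]
  exact fun l => isTypePlan_typePlan _ _ (q.2.1 l)

theorem exists_realizationPlan₁_eq [Fintype A] [Nonempty A] {p : stdSimplex ℝ K}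
    {x : K → (t : Fin T) → (Fin t → A × B) → A → ℝ} (hx : x ∈ planSet₁ p) :
    ∃ σ : Strategy₁ K A B T, realizationPlan₁ p σ = x := by
  choose σ hσ using fun k => (mem_planSet₁_iff.1 hx k).exists_typePlan
  exact ⟨σ, by rw [realizationPlan₁_eq]; funext k t h a; exact hσ k t h a⟩

theorem exists_realizationPlan₂_eq [Fintype B] [Nonempty B] {q : stdSimplex ℝ L}
    {y : L → (t : Fin T) → (Fin t → A × B) → B → ℝ} (hy : y ∈ planSet₂ q) :
    ∃ τ : Strategy₂ L A B T, realizationPlan₂ q τ = y := by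
  choose τ hτ using fun l => (mem_planSet₂_iff.1 hy l).exists_typePlan
  exact ⟨τ, by rw [realizationPlan₂_eq]; funext l t h b; exact hτ l t h b⟩

/-- Mass can only decrease along a history; this bound gives compactness of the plan set. -/
theorem IsTypePlan.le {π : A × B → C} {r : ℝ} {x : (t : Fin T) → (Fin t → A × B) → C → ℝ}
    (hx : IsTypePlan π r x) (t : Fin T) (h : Fin t → A × B) (c : C) : x t h c ≤ r := by
  have key : ∀ (n : ℕ) (hn : n < T) (h : Fin n → A × B) (c : C), x ⟨n, hn⟩ h c ≤ r := by
    intro n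
    induction n with
    | zero =>
      intro hn h c
      rw [← hx.first hn h]
      exact Finset.single_le_sum (fun c _ => hx.nonneg ⟨0, hn⟩ h c) (Finset.mem_univ c)
    | succ n ih =>
      intro hn h c
      obtain ⟨g, p, rfl⟩ : ∃ (g : Fin n → A × B) (p : A × B),
          h = Fin.snoc (α := fun _ => A × B) g p :=
        ⟨Fin.init (α := fun _ => A × B) h, h (Fin.last n),
          (Fin.snoc_init_self (α := fun _ => A × B) h).symm⟩
      refine le_trans ?_ (ih (n.lt_succ_self.trans hn) g (π p))
      rw [← hx.next n hn g p]
      exact Finset.single_le_sum (fun c _ => hx.nonneg ⟨n + 1, hn⟩ _ c) (Finset.mem_univ c)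
  exact key t t.isLt h c

theorem isCompact_setOf_isTypePlan (π : A × B → C) (r : ℝ) :
    IsCompact {x : (t : Fin T) → (Fin t → A × B) → C → ℝ | IsTypePlan π r x} := by
  refine (isCompact_Icc (a := fun _ _ _ => (0 : ℝ)) (b := fun _ _ _ => r)).of_isClosed_subset ?_
    fun x hx => ⟨fun t h c => hx.nonneg t h c, fun t h c => hx.le t h c⟩
  have : {x : (t : Fin T) → (Fin t → A × B) → C → ℝ | IsTypePlan π r x} =
      {x | (∀ (hT : 0 < T) (h : Fin 0 → A × B), ∑ c, x ⟨0, hT⟩ h c = r) ∧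
        (∀ (t : ℕ) (ht : t + 1 < T) (h : Fin t → A × B) (p : A × B),
          ∑ c, x ⟨t + 1, ht⟩ (Fin.snoc (α := fun _ => A × B) h p) c =
            x ⟨t, t.lt_succ_self.trans ht⟩ h (π p)) ∧
        ∀ t h c, 0 ≤ x t h c} :=
    Set.ext fun x => ⟨fun h => ⟨h.1, h.2, h.3⟩, fun h => ⟨h.1, h.2.1, h.2.2⟩⟩
  rw [this]
  simp only [Set.ofPred_and, Set.ofPred_forall]
  refine IsClosed.inter ?_ (IsClosed.inter ?_ ?_)
  · exact isClosed_iInter fun hT => isClosed_iInter fun h => isClosed_eq (by fun_prop) (by fun_prop)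
  · exact isClosed_iInter fun t => isClosed_iInter fun ht => isClosed_iInter fun h =>
      isClosed_iInter fun p => isClosed_eq (by fun_prop) (by fun_prop)
  · exact isClosed_iInter fun t => isClosed_iInter fun h => isClosed_iInter fun c =>
      isClosed_le (by fun_prop) (by fun_prop)

theorem convex_setOf_isTypePlan (π : A × B → C) (r : ℝ) :
    Convex ℝ {x : (t : Fin T) → (Fin t → A × B) → C → ℝ | IsTypePlan π r x} := by
  intro x hx y hy a b ha hb hab
  refine ⟨fun hT h => ?_, fun t ht h p => ?_, fun t h c => ?_⟩
  · simp only [Pi.add_apply, Pi.smul_apply, smul_eq_mul, Finset.sum_add_distrib, ← Finset.mul_sum,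
      hx.first hT h, hy.first hT h]
    rw [← add_mul, hab, one_mul]
  · simp only [Pi.add_apply, Pi.smul_apply, smul_eq_mul, Finset.sum_add_distrib, ← Finset.mul_sum,
      hx.next t ht h p, hy.next t ht h p]
  · exact add_nonneg (mul_nonneg ha (hx.nonneg t h c)) (mul_nonneg hb (hy.nonneg t h c))

theorem planSet₁_eq_pi [Fintype A] (p : stdSimplex ℝ K) :
    planSet₁ (A := A) (B := B) (T := T) p =
      Set.pi Set.univ fun k => {x | IsTypePlan Prod.fst (p.1 k) x} :=
  Set.ext fun x => by simp [mem_planSet₁_iff]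

theorem planSet₂_eq_pi [Fintype B] (q : stdSimplex ℝ L) :
    planSet₂ (A := A) (B := B) (T := T) q =
      Set.pi Set.univ fun l => {y | IsTypePlan Prod.snd (q.1 l) y} :=
  Set.ext fun x => by simp [mem_planSet₂_iff]

end PlanSets

/-! ### The payoff as a bilinear form in the realization plans -/

section Payoff

variable {K L A B : Type*} [Fintype K] [Fintype L] [Fintype A] [Fintype B] {T : ℕ}

/-- The expected discounted stage payoff against each action of player 2 of type `l`, when player 1
uses the realization plan `x`. -/
def stagePayoff₁ (M : K → L → A → B → ℝ) (lam : ℝ)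
    (x : K → (t : Fin T) → (Fin t → A × B) → A → ℝ) (l : L) (t : Fin T) (h : Fin t → A × B)
    (b : B) : ℝ :=
  lam * (1 - lam) ^ (t : ℕ) * ∑ k, ∑ a, M k l a b * x k t h a

/-- The expected discounted stage payoff of each action of player 1 of type `k`, when player 2 uses
the realization plan `y`. -/
def stagePayoff₂ (M : K → L → A → B → ℝ) (lam : ℝ)
    (y : L → (t : Fin T) → (Fin t → A × B) → B → ℝ) (k : K) (t : Fin T) (h : Fin t → A × B)
    (a : A) : ℝ :=
  lam * (1 - lam) ^ (t : ℕ) * ∑ l, ∑ b, M k l a b * y l t h b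

/-- The expected payoff, weighted by the probabilities of the types of player 1, when player 2 is of
type `l`. -/
def typePayoff₁ (M : K → L → A → B → ℝ) (lam : ℝ) (p : stdSimplex ℝ K) (σ : Strategy₁ K A B T)
    (l : L) (τ : TypeStrategy A B B T) : ℝ :=
  ∑ k, p.1 k * ∑ ω : Fin T → A × B, playProb (σ k) τ ω *
    ∑ t : Fin T, lam * (1 - lam) ^ (t : ℕ) * M k l (ω t).1 (ω t).2

/-- The expected payoff, weighted by the probabilities of the types of player 2, when player 1 is of
type `k`. -/
def typePayoff₂ (M : K → L → A → B → ℝ) (lam : ℝ) (q : stdSimplex ℝ L) (τ : Strategy₂ L A B T)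
    (k : K) (σ : TypeStrategy A B A T) : ℝ :=
  ∑ l, q.1 l * ∑ ω : Fin T → A × B, playProb σ (τ l) ω *
    ∑ t : Fin T, lam * (1 - lam) ^ (t : ℕ) * M k l (ω t).1 (ω t).2

variable (M : K → L → A → B → ℝ) (lam : ℝ) (p : stdSimplex ℝ K) (q : stdSimplex ℝ L)

theorem payoff_eq_sum_typePayoff₁ (σ : Strategy₁ K A B T) (τ : Strategy₂ L A B T) :
    payoff M lam p q σ τ = ∑ l, q.1 l * typePayoff₁ M lam p σ l (τ l) := by
  unfold payoff typePayoff₁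
  rw [Finset.sum_comm]
  simp only [Finset.mul_sum]
  refine Finset.sum_congr rfl fun l _ => Finset.sum_congr rfl fun k _ =>
    Finset.sum_congr rfl fun ω _ => Finset.sum_congr rfl fun t _ => by ring

theorem payoff_eq_sum_typePayoff₂ (σ : Strategy₁ K A B T) (τ : Strategy₂ L A B T) :
    payoff M lam p q σ τ = ∑ k, p.1 k * typePayoff₂ M lam q τ k (σ k) := by
  unfold payoff typePayoff₂
  simp only [Finset.mul_sum]
  refine Finset.sum_congr rfl fun l _ => Finset.sum_congr rfl fun k _ =>
    Finset.sum_congr rfl fun ω _ => Finset.sum_congr rfl fun t _ => by ring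

omit [Fintype L] in
theorem typePayoff₁_eq (σ : Strategy₁ K A B T) (l : L) (τ : TypeStrategy A B B T) :
    typePayoff₁ M lam p σ l τ =
      ∑ t, ∑ h, ∑ b, stagePayoff₁ M lam (realizationPlan₁ p σ) l t h b *
        typePlan Prod.snd τ t h b := by
  unfold typePayoff₁ stagePayoff₁
  have hk : ∀ k, ∑ ω : Fin T → A × B, playProb (σ k) τ ω *
      ∑ t : Fin T, lam * (1 - lam) ^ (t : ℕ) * M k l (ω t).1 (ω t).2 = _ := fun k =>
    sum_playProb_mul (σ k) τ fun t c => lam * (1 - lam) ^ (t : ℕ) * M k l c.1 c.2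
  simp only [hk]
  simp only [realizationPlan₁_eq, Finset.mul_sum, Finset.sum_mul, Fintype.sum_prod_type]
  rw [Finset.sum_comm]
  refine Finset.sum_congr rfl fun t _ => ?_
  rw [Finset.sum_comm]
  refine Finset.sum_congr rfl fun h _ => ?_
  conv_rhs => rw [Finset.sum_comm]
  refine Finset.sum_congr rfl fun k _ => ?_
  rw [Finset.sum_comm]
  exact Finset.sum_congr rfl fun b _ => Finset.sum_congr rfl fun a _ => by ring

omit [Fintype K] in
theorem typePayoff₂_eq (τ : Strategy₂ L A B T) (k : K) (σ : TypeStrategy A B A T) :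
    typePayoff₂ M lam q τ k σ =
      ∑ t, ∑ h, ∑ a, stagePayoff₂ M lam (realizationPlan₂ q τ) k t h a *
        typePlan Prod.fst σ t h a := by
  unfold typePayoff₂ stagePayoff₂
  have hl : ∀ l, ∑ ω : Fin T → A × B, playProb σ (τ l) ω *
      ∑ t : Fin T, lam * (1 - lam) ^ (t : ℕ) * M k l (ω t).1 (ω t).2 = _ := fun l =>
    sum_playProb_mul σ (τ l) fun t c => lam * (1 - lam) ^ (t : ℕ) * M k l c.1 c.2
  simp only [hl]
  simp only [realizationPlan₂_eq, Finset.mul_sum, Finset.sum_mul, Fintype.sum_prod_type]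
  rw [Finset.sum_comm]
  refine Finset.sum_congr rfl fun t _ => ?_
  rw [Finset.sum_comm]
  refine Finset.sum_congr rfl fun h _ => ?_
  rw [Finset.sum_comm]
  exact Finset.sum_congr rfl fun a _ => Finset.sum_congr rfl fun l _ =>
    Finset.sum_congr rfl fun b _ => by ring

/-- The payoff as a function of the realization plans. -/
def planPayoff (x : K → (t : Fin T) → (Fin t → A × B) → A → ℝ)
    (y : L → (t : Fin T) → (Fin t → A × B) → B → ℝ) : ℝ :=
  ∑ l, ∑ t, ∑ h, ∑ b, stagePayoff₁ M lam x l t h b * y l t h b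

/-- The type probabilities are absorbed into the plans, so the payoff becomes bilinear, which it is
not in the behavior strategies. -/
theorem payoff_eq_planPayoff (σ : Strategy₁ K A B T) (τ : Strategy₂ L A B T) :
    payoff M lam p q σ τ =
      planPayoff M lam (realizationPlan₁ p σ) (realizationPlan₂ q τ) := by
  rw [payoff_eq_sum_typePayoff₁, planPayoff]
  refine Finset.sum_congr rfl fun l _ => ?_
  rw [typePayoff₁_eq]
  simp only [Finset.mul_sum, realizationPlan₂_eq]
  exact Finset.sum_congr rfl fun t _ => Finset.sum_congr rfl fun h _ =>
    Finset.sum_congr rfl fun b _ => mul_left_comm _ _ _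

theorem planPayoff_left (x x' : K → (t : Fin T) → (Fin t → A × B) → A → ℝ)
    (y : L → (t : Fin T) → (Fin t → A × B) → B → ℝ) (a b : ℝ) :
    planPayoff M lam (a • x + b • x') y = a * planPayoff M lam x y + b * planPayoff M lam x' y := by
  simp only [planPayoff, stagePayoff₁, Finset.mul_sum, Finset.sum_mul, ← Finset.sum_add_distrib,
    Pi.add_apply, Pi.smul_apply, smul_eq_mul]
  refine Finset.sum_congr rfl fun _ _ => Finset.sum_congr rfl fun _ _ =>
    Finset.sum_congr rfl fun _ _ => Finset.sum_congr rfl fun _ _ =>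
    Finset.sum_congr rfl fun _ _ => Finset.sum_congr rfl fun _ _ => by ring

theorem planPayoff_right (x : K → (t : Fin T) → (Fin t → A × B) → A → ℝ)
    (y y' : L → (t : Fin T) → (Fin t → A × B) → B → ℝ) (a b : ℝ) :
    planPayoff M lam x (a • y + b • y') = a * planPayoff M lam x y + b * planPayoff M lam x y' := by
  simp only [planPayoff, Finset.mul_sum, ← Finset.sum_add_distrib,
    Pi.add_apply, Pi.smul_apply, smul_eq_mul]
  refine Finset.sum_congr rfl fun _ _ => Finset.sum_congr rfl fun _ _ =>
    Finset.sum_congr rfl fun _ _ => Finset.sum_congr rfl fun _ _ => by ring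

/-- The game has a saddle point. -/
theorem exists_saddle [Nonempty A] [Nonempty B] (T : ℕ) :
    ∃ (σ₀ : Strategy₁ K A B T) (τ₀ : Strategy₂ L A B T),
      (∀ σ, payoff M lam p q σ τ₀ ≤ payoff M lam p q σ₀ τ₀) ∧
      ∀ τ, payoff M lam p q σ₀ τ₀ ≤ payoff M lam p q σ₀ τ := by
  have ne₁ : Nonempty (stdSimplex ℝ A) := by
    classical exact ⟨_, single_mem_stdSimplex ℝ (Classical.arbitrary A)⟩
  have ne₂ : Nonempty (stdSimplex ℝ B) := by
    classical exact ⟨_, single_mem_stdSimplex ℝ (Classical.arbitrary B)⟩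
  have hX : Convex ℝ (planSet₁ (A := A) (B := B) (T := T) p) := by
    rw [planSet₁_eq_pi]
    exact convex_pi fun k _ => convex_setOf_isTypePlan _ _
  have hY : Convex ℝ (planSet₂ (A := A) (B := B) (T := T) q) := by
    rw [planSet₂_eq_pi]
    exact convex_pi fun l _ => convex_setOf_isTypePlan _ _
  have hX' : IsCompact (planSet₁ (A := A) (B := B) (T := T) p) := by
    rw [planSet₁_eq_pi]
    exact isCompact_univ_pi fun k => isCompact_setOf_isTypePlan _ _
  have hY' : IsCompact (planSet₂ (A := A) (B := B) (T := T) q) := by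
    rw [planSet₂_eq_pi]
    exact isCompact_univ_pi fun l => isCompact_setOf_isTypePlan _ _
  -- The minimizer's plan is taken as the first variable of the saddle function.
  obtain ⟨y, hy, x, hx, hs⟩ := Sion.exists_isSaddlePointOn
    (f := fun y x => planPayoff M lam x y)
    ⟨_, realizationPlan₂_mem q fun _ _ _ => Classical.arbitrary _⟩ hY hY'
    (fun x _ => (Continuous.lowerSemicontinuous
      (by unfold planPayoff stagePayoff₁; fun_prop)).lowerSemicontinuousOn _)
    (fun x _ => ConvexOn.quasiconvexOn
      ⟨hY, fun y _ y' _ a b _ _ _ => (planPayoff_right M lam x y y' a b).le⟩)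
    hX ⟨_, realizationPlan₁_mem p fun _ _ _ => Classical.arbitrary _⟩ hX'
    (fun y _ => (Continuous.upperSemicontinuous
      (by unfold planPayoff stagePayoff₁; fun_prop)).upperSemicontinuousOn _)
    (fun y _ => ConcaveOn.quasiconcaveOn
      ⟨hX, fun x _ x' _ a b _ _ _ => (planPayoff_left M lam x x' y a b).ge⟩)
  obtain ⟨σ₀, rfl⟩ := exists_realizationPlan₁_eq hx
  obtain ⟨τ₀, rfl⟩ := exists_realizationPlan₂_eq hy
  refine ⟨σ₀, τ₀, fun σ => ?_, fun τ => ?_⟩ <;> simp only [payoff_eq_planPayoff]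
  · exact hs _ hy _ (realizationPlan₁_mem p σ)
  · exact hs _ (realizationPlan₂_mem q τ) _ hx

end Payoff

/-! ### The linear programs and the Bellman inequalities -/

section LinearPrograms

variable {K L A B : Type*} [Fintype K] [Fintype L] [Fintype A] [Fintype B] {T : ℕ}

omit [Fintype L] in
-- The program measures continuation values in units of the next stage. Multiplying by `(1 - lam) ^
-- (t + 1)` returns them to units of the first stage; this factor is positive, so the constraints
-- are equivalent.
theorem feasible₁_iff {M : K → L → A → B → ℝ} {lam : ℝ} (hlam : lam < 1) {p : stdSimplex ℝ K}
    {x : K → (t : Fin T) → (Fin t → A × B) → A → ℝ}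
    {u : L → (t : Fin T) → (Fin t → A × B) → A → B → ℝ} {u₀ : L → ℝ} :
    Feasible₁ M lam p x u u₀ ↔ x ∈ planSet₁ p ∧ ∀ l, IsBellman Prod.snd (stagePayoff₁ M lam x l)
      (fun t h c => (1 - lam) ^ ((t : ℕ) + 1) * u l t h c.1 c.2) (u₀ l) := by
  have hpos : ∀ n : ℕ, 0 < (1 - lam) ^ n := fun n => pow_pos (sub_pos.2 hlam) n
  have hrhs : ∀ (l : L) (t : Fin T) (h : Fin t → A × B) (b : B), stagePayoff₁ M lam x l t h b +
      fiberSum Prod.snd (fun c => (1 - lam) ^ ((t : ℕ) + 1) * u l t h c.1 c.2) b =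
      (1 - lam) ^ (t : ℕ) * (lam * ∑ k, ∑ a, M k l a b * x k t h a +
        (1 - lam) * ∑ a, u l t h a b) := by
    intro l t h b
    rw [fiberSum_snd, stagePayoff₁, ← Finset.mul_sum]
    ring
  constructor
  · intro H
    refine ⟨H.plan, fun l => ⟨fun hT h b => ?_, fun t ht h c b => ?_, fun t ht h c => ?_⟩⟩
    · rw [hrhs, pow_zero, one_mul]
      exact H.first hT l h b
    · rw [hrhs]
      exact mul_le_mul_of_nonneg_left (H.next t ht l h c.1 c.2 b) (hpos _).le
    · rw [H.last t ht, mul_zero]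
  · rintro ⟨hx, H⟩
    refine ⟨hx, fun hT l h b => ?_, fun t ht l h a b b' => ?_, fun t ht l h a b => ?_⟩
    · have := (H l).first hT h b
      rwa [hrhs, pow_zero, one_mul] at this
    · have := (H l).next t ht h (a, b) b'
      rw [hrhs] at this
      exact le_of_mul_le_mul_left this (hpos _)
    · exact (mul_eq_zero.1 ((H l).last t ht h (a, b))).resolve_left (hpos _).ne'

omit [Fintype K] in
-- Negating payoffs and values turns the maximizing responder into a minimizing one.
theorem feasible₂_iff {M : K → L → A → B → ℝ} {lam : ℝ} (hlam : lam < 1) {q : stdSimplex ℝ L}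
    {y : L → (t : Fin T) → (Fin t → A × B) → B → ℝ}
    {w : K → (t : Fin T) → (Fin t → A × B) → A → B → ℝ} {w₀ : K → ℝ} :
    Feasible₂ M lam q y w w₀ ↔ y ∈ planSet₂ q ∧ ∀ k, IsBellman Prod.fst
      (fun t h a => -stagePayoff₂ M lam y k t h a)
      (fun t h c => -((1 - lam) ^ ((t : ℕ) + 1) * w k t h c.1 c.2)) (-w₀ k) := by
  have hpos : ∀ n : ℕ, 0 < (1 - lam) ^ n := fun n => pow_pos (sub_pos.2 hlam) n
  have hrhs : ∀ (k : K) (t : Fin T) (h : Fin t → A × B) (a : A), -stagePayoff₂ M lam y k t h a +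
      fiberSum Prod.fst (fun c => -((1 - lam) ^ ((t : ℕ) + 1) * w k t h c.1 c.2)) a =
      -((1 - lam) ^ (t : ℕ) * (lam * ∑ l, ∑ b, M k l a b * y l t h b +
        (1 - lam) * ∑ b, w k t h a b)) := by
    intro k t h a
    rw [fiberSum_neg, fiberSum_fst, stagePayoff₂, ← Finset.mul_sum]
    ring
  constructor
  · intro H
    refine ⟨H.plan, fun k => ⟨fun hT h a => ?_, fun t ht h c a => ?_, fun t ht h c => ?_⟩⟩
    · rw [hrhs, pow_zero, one_mul]
      exact neg_le_neg (H.first hT k h a)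
    · rw [hrhs]
      exact neg_le_neg (mul_le_mul_of_nonneg_left (H.next t ht k h c.1 c.2 a) (hpos _).le)
    · rw [H.last t ht, mul_zero, neg_zero]
  · rintro ⟨hy, H⟩
    refine ⟨hy, fun hT k h a => ?_, fun t ht k h a b a' => ?_, fun t ht k h a b => ?_⟩
    · have := (H k).first hT h a
      rw [hrhs, pow_zero, one_mul] at this
      exact neg_le_neg_iff.1 this
    · have := (H k).next t ht h (a, b) a'
      rw [hrhs] at this
      exact le_of_mul_le_mul_left (neg_le_neg_iff.1 this) (hpos _)
    · exact (mul_eq_zero.1 (neg_eq_zero.1 ((H k).last t ht h (a, b)))).resolve_left (hpos _).ne'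

variable {M : K → L → A → B → ℝ} {lam : ℝ} {p : stdSimplex ℝ K} {q : stdSimplex ℝ L}

omit [Fintype L] in
theorem Feasible₁.le_typePayoff₁ (hlam : lam < 1) (hT : 0 < T) {σ : Strategy₁ K A B T}
    {u : L → (t : Fin T) → (Fin t → A × B) → A → B → ℝ} {u₀ : L → ℝ}
    (H : Feasible₁ M lam p (realizationPlan₁ p σ) u u₀) (l : L) (τ : TypeStrategy A B B T) :
    u₀ l ≤ typePayoff₁ M lam p σ l τ := by
  rw [typePayoff₁_eq]
  exact (((feasible₁_iff hlam).1 H).2 l).le_sum hT τ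

omit [Fintype K] in
theorem Feasible₂.typePayoff₂_le (hlam : lam < 1) (hT : 0 < T) {τ : Strategy₂ L A B T}
    {w : K → (t : Fin T) → (Fin t → A × B) → A → B → ℝ} {w₀ : K → ℝ}
    (H : Feasible₂ M lam q (realizationPlan₂ q τ) w w₀) (k : K) (σ : TypeStrategy A B A T) :
    typePayoff₂ M lam q τ k σ ≤ w₀ k := by
  rw [typePayoff₂_eq]
  have := (((feasible₂_iff hlam).1 H).2 k).le_sum hT σ
  simp only [neg_mul, Finset.sum_neg_distrib] at this
  exact neg_le_neg_iff.1 this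

theorem Feasible₁.le_payoff (hlam : lam < 1) (hT : 0 < T) {σ : Strategy₁ K A B T}
    {u : L → (t : Fin T) → (Fin t → A × B) → A → B → ℝ} {u₀ : L → ℝ}
    (H : Feasible₁ M lam p (realizationPlan₁ p σ) u u₀) (q : stdSimplex ℝ L)
    (τ : Strategy₂ L A B T) : ∑ l, q.1 l * u₀ l ≤ payoff M lam p q σ τ := by
  rw [payoff_eq_sum_typePayoff₁]
  exact Finset.sum_le_sum fun l _ =>
    mul_le_mul_of_nonneg_left (H.le_typePayoff₁ hlam hT l (τ l)) (q.2.1 l)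

theorem Feasible₂.payoff_le (hlam : lam < 1) (hT : 0 < T) {τ : Strategy₂ L A B T}
    {w : K → (t : Fin T) → (Fin t → A × B) → A → B → ℝ} {w₀ : K → ℝ}
    (H : Feasible₂ M lam q (realizationPlan₂ q τ) w w₀) (p : stdSimplex ℝ K)
    (σ : Strategy₁ K A B T) : payoff M lam p q σ τ ≤ ∑ k, p.1 k * w₀ k := by
  rw [payoff_eq_sum_typePayoff₂]
  exact Finset.sum_le_sum fun k _ =>
    mul_le_mul_of_nonneg_left (H.typePayoff₂_le hlam hT k (σ k)) (p.2.1 k)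

/-- Tightness of the program for a fixed plan: each type of player 2 takes a backward-induction
response, and dividing its values by `(1 - lam) ^ (t + 1)` gives a feasible `u`. -/
theorem exists_feasible₁_eq_payoff [Nonempty B] (M : K → L → A → B → ℝ) (hlam : lam < 1)
    (hT : 0 < T) (p : stdSimplex ℝ K) (q : stdSimplex ℝ L) (σ : Strategy₁ K A B T) :
    ∃ (u : L → (t : Fin T) → (Fin t → A × B) → A → B → ℝ) (u₀ : L → ℝ) (τ : Strategy₂ L A B T),
      Feasible₁ M lam p (realizationPlan₁ p σ) u u₀ ∧
        ∑ l, q.1 l * u₀ l = payoff M lam p q σ τ := by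
  choose U u₀ τ hU hτ using fun l =>
    exists_isBellman_eq_sum Prod.snd hT (stagePayoff₁ M lam (realizationPlan₁ p σ) l)
  refine ⟨fun l t h a b => U l t h (a, b) / (1 - lam) ^ ((t : ℕ) + 1), u₀, τ,
    (feasible₁_iff hlam).2 ⟨realizationPlan₁_mem p σ, fun l => ?_⟩, ?_⟩
  · convert hU l using 4
    exact mul_div_cancel₀ _ (pow_pos (sub_pos.2 hlam) _).ne'
  · rw [payoff_eq_sum_typePayoff₁]
    simp only [typePayoff₁_eq, hτ]

theorem exists_feasible₂_eq_payoff [Nonempty A] (M : K → L → A → B → ℝ) (hlam : lam < 1)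
    (hT : 0 < T) (p : stdSimplex ℝ K) (q : stdSimplex ℝ L) (τ : Strategy₂ L A B T) :
    ∃ (w : K → (t : Fin T) → (Fin t → A × B) → A → B → ℝ) (w₀ : K → ℝ) (σ : Strategy₁ K A B T),
      Feasible₂ M lam q (realizationPlan₂ q τ) w w₀ ∧
        ∑ k, p.1 k * w₀ k = payoff M lam p q σ τ := by
  choose U u₀ σ hU hσ using fun k => exists_isBellman_eq_sum Prod.fst hT
    fun t h a => -stagePayoff₂ M lam (realizationPlan₂ q τ) k t h a
  refine ⟨fun k t h a b => -U k t h (a, b) / (1 - lam) ^ ((t : ℕ) + 1), fun k => -u₀ k, σ,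
    (feasible₂_iff hlam).2 ⟨realizationPlan₂_mem q τ, fun k => ?_⟩, ?_⟩
  · convert hU k using 4
    · rw [mul_div_cancel₀ _ (pow_pos (sub_pos.2 hlam) _).ne', neg_neg]
    · exact neg_neg _
  · rw [payoff_eq_sum_typePayoff₂]
    simp only [typePayoff₂_eq, ← hσ, neg_mul, Finset.sum_neg_distrib, neg_neg]

/-- With no stage played, the conditioning and the stage filters are vacuous. -/
theorem condFuturePayoff_zero (Mkl : A → B → ℝ) (lam : ℝ) (σ : TypeStrategy A B A T)
    (τ : TypeStrategy A B B T) :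
    condFuturePayoff Mkl lam σ τ (Nat.zero_le T) Fin.elim0 =
      ∑ ω : Fin T → A × B, playProb σ τ ω *
        ∑ t : Fin T, lam * (1 - lam) ^ (t : ℕ) * Mkl (ω t).1 (ω t).2 := by
  have h : ∀ ω : Fin T → A × B, firstPairs ω 0 (Nat.zero_le T) = Fin.elim0 := fun ω =>
    Subsingleton.elim _ _
  simp [condFuturePayoff, playProb, h]

omit [Fintype L] in
theorem isFutureSecurityPayoff₁_zero_iff {σ : Strategy₁ K A B T} {l : L} {v : ℝ} :
    IsFutureSecurityPayoff₁ M lam p σ l (Nat.zero_le T) Fin.elim0 v ↔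
      IsLeast (Set.range fun τ : TypeStrategy A B B T => typePayoff₁ M lam p σ l τ) v := by
  simp [IsFutureSecurityPayoff₁, condFuturePayoff_zero, typePayoff₁, weight₁]

omit [Fintype K] in
theorem isFutureSecurityPayoff₂_zero_iff {τ : Strategy₂ L A B T} {k : K} {v : ℝ} :
    IsFutureSecurityPayoff₂ M lam q τ k (Nat.zero_le T) Fin.elim0 v ↔
      IsGreatest (Set.range fun σ : TypeStrategy A B A T => typePayoff₂ M lam q τ k σ) v := by
  simp [IsFutureSecurityPayoff₂, condFuturePayoff_zero, typePayoff₂, weight₂]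

end LinearPrograms

/-- A term with positive weight is equal in two weighted sums that agree, one dominating the other
term by term. -/
theorem eq_of_sum_mul_le {ι : Type*} [Fintype ι] {q f g : ι → ℝ} (hq : ∀ i, 0 ≤ q i)
    (hfg : ∀ i, f i ≤ g i) (h : ∑ i, q i * g i ≤ ∑ i, q i * f i) {i : ι} (hi : 0 < q i) :
    f i = g i := by
  have hle : ∀ j ∈ Finset.univ, q j * f j ≤ q j * g j := fun j _ =>
    mul_le_mul_of_nonneg_left (hfg j) (hq j)
  have := (Finset.sum_eq_sum_iff_of_le hle).1 (le_antisymm (Finset.sum_le_sum hle) h) i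
    (Finset.mem_univ i)
  exact mul_left_cancel₀ hi.ne' this

end DiscountedBayesianGame

end

theorem mainTheorem6 {K L A B : Type*} [Fintype K] [Fintype L] [Fintype A] [Fintype B]
    [Nonempty K] [Nonempty L] [Nonempty A] [Nonempty B]
    (M : K → L → A → B → ℝ) (p : stdSimplex ℝ K) (q : stdSimplex ℝ L)
    (lam : ℝ) (hlam : lam ∈ Set.Ioo (0 : ℝ) 1) (T : ℕ) (hT : 1 ≤ T) :
    ∃ V : ℝ, IsValue M lam p q T V ∧
      -- the linear program of player 1
      IsGreatest {r : ℝ | ∃ (x : K → (t : Fin T) → (Fin t → A × B) → A → ℝ)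
        (u : L → (t : Fin T) → (Fin t → A × B) → A → B → ℝ) (u₀ : L → ℝ),
        Feasible₁ M lam p x u u₀ ∧ r = ∑ l, q.1 l * u₀ l} V ∧
      (∀ (x : K → (t : Fin T) → (Fin t → A × B) → A → ℝ)
        (u : L → (t : Fin T) → (Fin t → A × B) → A → B → ℝ) (u₀ : L → ℝ),
        Feasible₁ M lam p x u u₀ → ∑ l, q.1 l * u₀ l = V →
        (∃ σ : Strategy₁ K A B T, realizationPlan₁ p σ = x) ∧
        ∀ σ : Strategy₁ K A B T, realizationPlan₁ p σ = x →
          IsSecurity₁ M lam p q σ ∧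
          ∀ l, 0 < q.1 l → IsFutureSecurityPayoff₁ M lam p σ l (Nat.zero_le T) Fin.elim0 (u₀ l)) ∧
      -- the linear program of player 2
      IsLeast {r : ℝ | ∃ (y : L → (t : Fin T) → (Fin t → A × B) → B → ℝ)
        (w : K → (t : Fin T) → (Fin t → A × B) → A → B → ℝ) (w₀ : K → ℝ),
        Feasible₂ M lam q y w w₀ ∧ r = ∑ k, p.1 k * w₀ k} V ∧
      (∀ (y : L → (t : Fin T) → (Fin t → A × B) → B → ℝ)
        (w : K → (t : Fin T) → (Fin t → A × B) → A → B → ℝ) (w₀ : K → ℝ),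
        Feasible₂ M lam q y w w₀ → ∑ k, p.1 k * w₀ k = V →
        (∃ τ : Strategy₂ L A B T, realizationPlan₂ q τ = y) ∧
        ∀ τ : Strategy₂ L A B T, realizationPlan₂ q τ = y →
          IsSecurity₂ M lam p q τ ∧
          ∀ k, 0 < p.1 k → IsFutureSecurityPayoff₂ M lam q τ k (Nat.zero_le T) Fin.elim0 (w₀ k)) := by
  obtain ⟨-, hlam⟩ := hlam
  obtain ⟨σ₀, τ₀, hσ₀, hτ₀⟩ := exists_saddle M lam p q T
  -- A strategy guaranteeing at least the saddle payoff guarantees exactly that: `τ₀` concedes no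
  -- more.
  have hG₁ : ∀ σ : Strategy₁ K A B T,
      (∀ τ, payoff M lam p q σ₀ τ₀ ≤ payoff M lam p q σ τ) →
      Guarantees₁ M lam p q σ (payoff M lam p q σ₀ τ₀) := fun σ hσ =>
    ⟨⟨τ₀, le_antisymm (hσ₀ σ) (hσ τ₀)⟩, by rintro _ ⟨τ, rfl⟩; exact hσ τ⟩
  have hG₂ : ∀ τ : Strategy₂ L A B T,
      (∀ σ, payoff M lam p q σ τ ≤ payoff M lam p q σ₀ τ₀) →
      Guarantees₂ M lam p q τ (payoff M lam p q σ₀ τ₀) := fun τ hτ =>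
    ⟨⟨σ₀, le_antisymm (hτ σ₀) (hτ₀ τ)⟩, by rintro _ ⟨σ, rfl⟩; exact hτ σ⟩
  have hV : IsValue M lam p q T (payoff M lam p q σ₀ τ₀) := by
    refine ⟨⟨⟨σ₀, hG₁ σ₀ hτ₀⟩, ?_⟩, ⟨τ₀, hG₂ τ₀ hσ₀⟩, ?_⟩
    · rintro v ⟨σ, hσ⟩
      exact (hσ.2 ⟨τ₀, rfl⟩).trans (hσ₀ σ)
    · rintro v ⟨τ, hτ⟩
      exact (hτ₀ τ).trans (hτ.2 ⟨σ₀, rfl⟩)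
  refine ⟨payoff M lam p q σ₀ τ₀, hV, ⟨?_, ?_⟩, ?_, ⟨?_, ?_⟩, ?_⟩
  · obtain ⟨u, u₀, τ, hF, hτ⟩ := exists_feasible₁_eq_payoff M hlam hT p q σ₀
    -- The tight solution for `σ₀` has objective `payoff σ₀ τ`, at least the value by the saddle
    -- inequality and at most the value by weak duality against `τ₀`.
    exact ⟨_, u, u₀, hF, le_antisymm (hτ ▸ hτ₀ τ) (hF.le_payoff hlam hT q τ₀)⟩
  · rintro _ ⟨x, u, u₀, hF, rfl⟩
    obtain ⟨σ, rfl⟩ := exists_realizationPlan₁_eq hF.plan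
    exact (hF.le_payoff hlam hT q τ₀).trans (hσ₀ σ)
  · intro x u u₀ hF hopt
    refine ⟨exists_realizationPlan₁_eq hF.plan, ?_⟩
    rintro σ rfl
    refine ⟨⟨_, hV.1, hG₁ σ fun τ => hopt ▸ hF.le_payoff hlam hT q τ⟩, fun l hl => ?_⟩
    rw [isFutureSecurityPayoff₁_zero_iff]
    refine ⟨⟨τ₀ l, ?_⟩, by rintro _ ⟨τ, rfl⟩; exact hF.le_typePayoff₁ hlam hT l τ⟩
    -- The types of `τ₀` receive at least `u₀` termwise, but on average at most the value, which is
    -- the average of `u₀`. So `τ₀ l` attains the minimum for each type of positive probability.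
    refine (eq_of_sum_mul_le q.2.1 (fun l => hF.le_typePayoff₁ hlam hT l (τ₀ l)) ?_ hl).symm
    rw [← payoff_eq_sum_typePayoff₁, hopt]
    exact hσ₀ σ
  · obtain ⟨w, w₀, σ, hF, hσ⟩ := exists_feasible₂_eq_payoff M hlam hT p q τ₀
    exact ⟨_, w, w₀, hF, le_antisymm (hF.payoff_le hlam hT p σ₀) (hσ ▸ hσ₀ σ)⟩
  · rintro _ ⟨y, w, w₀, hF, rfl⟩
    obtain ⟨τ, rfl⟩ := exists_realizationPlan₂_eq hF.plan
    exact (hτ₀ τ).trans (hF.payoff_le hlam hT p σ₀)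
  · intro y w w₀ hF hopt
    refine ⟨exists_realizationPlan₂_eq hF.plan, ?_⟩
    rintro τ rfl
    refine ⟨⟨_, hV.2, hG₂ τ fun σ => hopt ▸ hF.payoff_le hlam hT p σ⟩, fun k hk => ?_⟩
    rw [isFutureSecurityPayoff₂_zero_iff]
    refine ⟨⟨σ₀ k, ?_⟩, by rintro _ ⟨σ, rfl⟩; exact hF.typePayoff₂_le hlam hT k σ⟩
    refine eq_of_sum_mul_le p.2.1 (fun k => hF.typePayoff₂_le hlam hT k (σ₀ k)) ?_ hk
    rw [← payoff_eq_sum_typePayoff₂, hopt]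
    exact hτ₀ τ
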